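/- For a positive integer $n$ and $0<p<1$, let $\mu_p$ denote the $p$-biased probability measure on the subsets of $[n]=\{1,\dots,n\}$ (identified with $\{0,1\}^n$), that is, $\mu_p(\mathcal{A})=\sum_{A\in\mathcal{A}}p^{|A|}(1-p)^{n-|A|}$ for every family $\mathcal{A}$ of subsets of $[n]$. Given a set $L$ of nonnegative integers and two families $\mathcal{F},\mathcal{G}$ of subsets of $[n]$, we say that the cross intersections of $\mathcal{F}$ and $\mathcal{G}$ forbid $L$ if $|A\cap B|\notin L$ for every $A\in\mathcal{F}$ and every $B\in\mathcal{G}$. Lemma 3.3. Let $n$ be a positive integer, let $p,p'$ be real numbers with $0<p\le p'\le 1-p$ and $p\le\frac12$, and let $\alpha$ be a positive integer with $\alpha\le pn$. Let $\mathcal{F},\mathcal{G}$ be two families of subsets of $[n]$. (i) If the cross intersections of $\mathcal{F}$ and $\mathcal{G}$ forbid $\{k\in\mathbb{Z}:0\le k\le\alpha\}$, then \[ \mu_p(\mathcal{F})\,\mu_{p'}(\mathcal{G})\le\exp\Big(-\frac{\alpha^2}{24\,p(1-p)\,n}\Big). \] (ii) If the cross intersections of $\mathcal{F}$ and $\mathcal{G}$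 forbid $\{k\in\mathbb{Z}:pn-\alpha\le k\le n\}$, then \[ \mu_p(\mathcal{F})\,\mu_{p'}(\mathcal{G})\le 2\exp\Big(-\frac{\alpha^2}{24\,p(1-p)\,n}\Big). \] -/

import Mathlib

/-- The `p`-biased measure `μ_p(𝓐) = ∑_{A ∈ 𝓐} p^|A| (1-p)^(n-|A|)` of a family `𝓐` of subsets
of an `n`-element set; points of `{0,1}^n` are identified with subsets of `Fin n`. -/
noncomputable def biasedMeasure {n : ℕ} (p : ℝ) (𝓐 : Finset (Finset (Fin n))) : ℝ :=
  ∑ A ∈ 𝓐, p ^ A.card * (1 - p) ^ (n - A.card)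

/-- The cross intersections of `𝓕` and `𝓖` forbid `L`: `|A ∩ B| ∉ L` for all `A ∈ 𝓕`, `B ∈ 𝓖`. -/
def Forbid (n : ℕ) (L : Set ℕ) (𝓕 𝓖 : Finset (Finset (Fin n))) : Prop :=
  ∀ A ∈ 𝓕, ∀ B ∈ 𝓖, (A ∩ B).card ∉ L

/-
Part (ii). Since `p ≤ p'`, the four functions theorem gives
`μ_p(𝓕) μ_{p'}(𝓖) ≤ μ_p({A ∩ B}) μ_{p'}({A ∪ B}) ≤ μ_p({A ∩ B})`, and all intersections lie in the
lower tail `|D| < pn - α`, which is small by Chernoff's bound.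

Part (i). Replacing `𝓖` by the family of complements turns `|A ∩ B|` into `|A \ B|` and `p'` into
`1 - p' ≥ p`. The four functions theorem then lets us pass from `𝓖` to its downward closure while
lowering the bias to `p`, which keeps `|A \ B| ≥ α`. A last application, to the indicators of the
two families against the exponentially tilted weights `w(D) e^{-s|D|}` and `w(U) e^{s|U|}`, exploits
`|A ∪ B| - |A ∩ B| ≥ α`; the first-order terms of the two moment generating functions cancel.
-/

open Finset
open scoped FinsetFamily

theorem four_functions_theorem_of_mem {α β : Type*} [DistribLattice α] [DecidableEq α]
    [CommSemiring β] [LinearOrder β] [IsStrictOrderedRing β] [ExistsAddOfLE β]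
    {f₁ f₂ f₃ f₄ : α → β} (h₁ : 0 ≤ f₁) (h₂ : 0 ≤ f₂) (h₃ : 0 ≤ f₃) (h₄ : 0 ≤ f₄)
    {s t : Finset α} (h : ∀ a ∈ s, ∀ b ∈ t, f₁ a * f₂ b ≤ f₃ (a ⊓ b) * f₄ (a ⊔ b)) :
    (∑ a ∈ s, f₁ a) * ∑ b ∈ t, f₂ b ≤ (∑ a ∈ s ⊼ t, f₃ a) * ∑ a ∈ s ⊻ t, f₄ a := by
  have restrict_nonneg {f : α → β} (hf : 0 ≤ f) (u : Finset α) :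
      0 ≤ fun a => if a ∈ u then f a else 0 := fun a => ite_nonneg (hf a) le_rfl
  have key := four_functions_theorem _ _ f₃ f₄ (restrict_nonneg h₁ s) (restrict_nonneg h₂ t)
    h₃ h₄ (fun a b => ?_) s t
  · simpa only [sum_ite_mem, inter_self] using key
  · have rhs_nonneg := mul_nonneg (h₃ (a ⊓ b)) (h₄ (a ⊔ b))
    by_cases ha : a ∈ s <;> by_cases hb : b ∈ t <;>
      simp only [ha, hb, if_true, if_false, zero_mul, mul_zero]
    exacts [h a ha b hb, rhs_nonneg, rhs_nonneg, rhs_nonneg]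

/-- The weight `p^|A| (1-p)^(n-|A|)` that the `p`-biased measure gives to a single subset `A` of
`Fin n`. -/
noncomputable def biasedWeight {n : ℕ} (p : ℝ) (A : Finset (Fin n)) : ℝ :=
  p ^ #A * (1 - p) ^ (n - #A)

section BiasedMeasure

variable {n : ℕ} {p r : ℝ}

theorem biasedMeasure_eq_sum_biasedWeight (p : ℝ) (𝓐 : Finset (Finset (Fin n))) :
    biasedMeasure p 𝓐 = ∑ A ∈ 𝓐, biasedWeight p A :=
  rfl

theorem biasedWeight_eq_prod (p : ℝ) (A : Finset (Fin n)) :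
    biasedWeight p A = ∏ i, if i ∈ A then p else 1 - p := by
  rw [prod_ite, prod_const, prod_const, filter_mem_eq_inter, univ_inter, filter_not,
    filter_mem_eq_inter, univ_inter, card_univ_sdiff, Fintype.card_fin, biasedWeight]

theorem biasedWeight_nonneg (hp : 0 ≤ p) (hp1 : p ≤ 1) (A : Finset (Fin n)) :
    0 ≤ biasedWeight p A :=
  mul_nonneg (pow_nonneg hp _) (pow_nonneg (sub_nonneg.2 hp1) _)

theorem biasedWeight_compl (p : ℝ) (A : Finset (Fin n)) :
    biasedWeight (1 - p) Aᶜ = biasedWeight p A := by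
  rw [biasedWeight_eq_prod, biasedWeight_eq_prod]
  refine prod_congr rfl fun i _ => ?_
  by_cases hi : i ∈ A <;> simp [hi]

theorem biasedWeight_mul_le (hp : 0 ≤ p) (hpr : p ≤ r) (hr : r ≤ 1) (A B : Finset (Fin n)) :
    biasedWeight p A * biasedWeight r B ≤ biasedWeight p (A ∩ B) * biasedWeight r (A ∪ B) := by
  simp only [biasedWeight_eq_prod, ← prod_mul_distrib]
  have h0 (i : Fin n) (C : Finset (Fin n)) : 0 ≤ if i ∈ C then p else 1 - p := by
    split_ifs <;> linarith
  have h1 (i : Fin n) (C : Finset (Fin n)) : 0 ≤ if i ∈ C then r else 1 - r := by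
    split_ifs <;> linarith
  refine prod_le_prod (fun i _ => mul_nonneg (h0 i A) (h1 i B)) fun i _ => ?_
  by_cases hA : i ∈ A <;> by_cases hB : i ∈ B <;> simp only [hA, hB, mem_inter, mem_union,
    and_true, and_false, or_true, or_false, if_true, if_false] <;> linarith

theorem sum_biasedWeight_mul_pow_card (n : ℕ) (p x : ℝ) :
    ∑ A : Finset (Fin n), biasedWeight p A * x ^ #A = (p * x + (1 - p)) ^ n := by
  have h := Fintype.sum_pow_mul_eq_add_pow (Fin n) (p * x) (1 - p)
  rw [Fintype.card_fin] at h
  rw [← h]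
  refine sum_congr rfl fun A _ => ?_
  rw [biasedWeight, mul_pow]
  ring

theorem biasedMeasure_nonneg (hp : 0 ≤ p) (hp1 : p ≤ 1) (𝓐 : Finset (Finset (Fin n))) :
    0 ≤ biasedMeasure p 𝓐 :=
  sum_nonneg fun A _ => biasedWeight_nonneg hp hp1 A

theorem biasedMeasure_univ (n : ℕ) (p : ℝ) :
    biasedMeasure p (univ : Finset (Finset (Fin n))) = 1 := by
  simpa [biasedMeasure_eq_sum_biasedWeight] using sum_biasedWeight_mul_pow_card n p 1

theorem biasedMeasure_le_one (hp : 0 ≤ p) (hp1 : p ≤ 1) (𝓐 : Finset (Finset (Fin n))) :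
    biasedMeasure p 𝓐 ≤ 1 :=
  (sum_le_sum_of_subset_of_nonneg (subset_univ 𝓐) fun A _ _ =>
    biasedWeight_nonneg hp hp1 A).trans_eq (biasedMeasure_univ n p)

theorem biasedMeasure_compls (p : ℝ) (𝓐 : Finset (Finset (Fin n))) :
    biasedMeasure (1 - p) 𝓐ᶜˢ = biasedMeasure p 𝓐 := by
  rw [← image_compl, biasedMeasure_eq_sum_biasedWeight, sum_image compl_injective.injOn]
  exact sum_congr rfl fun A _ => biasedWeight_compl p A

theorem biasedMeasure_mul_le_biasedMeasure_infs (hp : 0 ≤ p) (hpr : p ≤ r) (hr : r ≤ 1)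
    (𝓐 𝓑 : Finset (Finset (Fin n))) :
    biasedMeasure p 𝓐 * biasedMeasure r 𝓑 ≤ biasedMeasure p (𝓐 ⊼ 𝓑) := by
  have hp1 := hpr.trans hr
  have hr0 := hp.trans hpr
  calc biasedMeasure p 𝓐 * biasedMeasure r 𝓑
      ≤ biasedMeasure p (𝓐 ⊼ 𝓑) * biasedMeasure r (𝓐 ⊻ 𝓑) :=
        four_functions_theorem (biasedWeight p) (biasedWeight r) (biasedWeight p) (biasedWeight r)
          (biasedWeight_nonneg hp hp1) (biasedWeight_nonneg hr0 hr)
          (biasedWeight_nonneg hp hp1) (biasedWeight_nonneg hr0 hr)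
          (biasedWeight_mul_le hp hpr hr) 𝓐 𝓑
    _ ≤ biasedMeasure p (𝓐 ⊼ 𝓑) :=
        mul_le_of_le_one_right (biasedMeasure_nonneg hp hp1 _) (biasedMeasure_le_one hr0 hr _)

/-- `univ ⊼ 𝓐` is the downward closure of `𝓐`. -/
theorem biasedMeasure_le_biasedMeasure_univ_infs (hp : 0 ≤ p) (hpr : p ≤ r) (hr : r ≤ 1)
    (𝓐 : Finset (Finset (Fin n))) : biasedMeasure r 𝓐 ≤ biasedMeasure p (univ ⊼ 𝓐) := by
  simpa only [biasedMeasure_univ, one_mul] using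
    biasedMeasure_mul_le_biasedMeasure_infs hp hpr hr univ 𝓐

end BiasedMeasure

section Concentration

variable {n : ℕ} {p r s t : ℝ}

theorem bernoulli_mgf_le (hp : 0 ≤ p) (hp1 : p ≤ 1) (hs : |s| ≤ 1) :
    p * Real.exp s + (1 - p) ≤ Real.exp (p * s + p * (1 - p) * s ^ 2) := by
  have hq : 0 ≤ 1 - p := sub_nonneg.2 hp1
  have exp_le {y : ℝ} (hy : |y| ≤ 1) : Real.exp y ≤ 1 + y + y ^ 2 := by
    linarith [(abs_le.1 (Real.abs_exp_sub_one_sub_id_le hy)).2]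
  have h₁ : Real.exp ((1 - p) * s) ≤ 1 + (1 - p) * s + ((1 - p) * s) ^ 2 := exp_le <| by
    rw [abs_mul, abs_of_nonneg hq]
    exact mul_le_one₀ (by linarith) (abs_nonneg s) hs
  have h₀ : Real.exp (-(p * s)) ≤ 1 + -(p * s) + (-(p * s)) ^ 2 := exp_le <| by
    rw [abs_neg, abs_mul, abs_of_nonneg hp]
    exact mul_le_one₀ hp1 (abs_nonneg s) hs
  have centered : p * Real.exp ((1 - p) * s) + (1 - p) * Real.exp (-(p * s)) ≤
      Real.exp (p * (1 - p) * s ^ 2) :=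
    calc p * Real.exp ((1 - p) * s) + (1 - p) * Real.exp (-(p * s))
        ≤ p * (1 + (1 - p) * s + ((1 - p) * s) ^ 2) +
            (1 - p) * (1 + -(p * s) + (-(p * s)) ^ 2) := by gcongr
      _ = p * (1 - p) * s ^ 2 + 1 := by ring
      _ ≤ Real.exp (p * (1 - p) * s ^ 2) := Real.add_one_le_exp _
  calc p * Real.exp s + (1 - p)
      = Real.exp (p * s) *
          (p * Real.exp ((1 - p) * s) + (1 - p) * Real.exp (-(p * s))) := by
        have e₁ : Real.exp (p * s) * Real.exp ((1 - p) * s) = Real.exp s := by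
          rw [← Real.exp_add]; ring_nf
        have e₀ : Real.exp (p * s) * Real.exp (-(p * s)) = 1 := by
          rw [← Real.exp_add, add_neg_cancel, Real.exp_zero]
        linear_combination -p * e₁ - (1 - p) * e₀
    _ ≤ Real.exp (p * s) * Real.exp (p * (1 - p) * s ^ 2) := by gcongr
    _ = Real.exp (p * s + p * (1 - p) * s ^ 2) := (Real.exp_add _ _).symm

theorem sum_biasedWeight_mul_exp_le (hp : 0 ≤ p) (hp1 : p ≤ 1) (hs : |s| ≤ 1)
    (𝓐 : Finset (Finset (Fin n))) :
    ∑ A ∈ 𝓐, biasedWeight p A * Real.exp (s * #A) ≤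
      Real.exp (n * (p * s + p * (1 - p) * s ^ 2)) := by
  have mgf_nonneg : 0 ≤ p * Real.exp s + (1 - p) :=
    add_nonneg (mul_nonneg hp (Real.exp_nonneg s)) (sub_nonneg.2 hp1)
  calc ∑ A ∈ 𝓐, biasedWeight p A * Real.exp (s * #A)
      ≤ ∑ A, biasedWeight p A * Real.exp (s * #A) :=
        sum_le_sum_of_subset_of_nonneg (subset_univ 𝓐) fun A _ _ =>
          mul_nonneg (biasedWeight_nonneg hp hp1 A) (Real.exp_nonneg _)
    _ = (p * Real.exp s + (1 - p)) ^ n := by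
        simp only [← sum_biasedWeight_mul_pow_card, ← Real.exp_nat_mul, mul_comm s]
    _ ≤ Real.exp (p * s + p * (1 - p) * s ^ 2) ^ n :=
        pow_le_pow_left₀ mgf_nonneg (bernoulli_mgf_le hp hp1 hs) n
    _ = Real.exp (n * (p * s + p * (1 - p) * s ^ 2)) := (Real.exp_nat_mul _ _).symm

/-- The minimum of `s ↦ a s² - s t`, attained at `s = t / (2a)`. -/
theorem exists_neg_mul_add_mul_sq_eq {a : ℝ} (ha : 0 < a) (ht : 0 ≤ t) (hta : t ≤ 2 * a) :
    ∃ s, 0 ≤ s ∧ s ≤ 1 ∧ -(s * t) + a * s ^ 2 = -(t ^ 2 / (4 * a)) := by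
  refine ⟨t / (2 * a), by positivity, (div_le_one (by positivity)).2 hta, ?_⟩
  field_simp
  ring

theorem biasedMeasure_le_of_card_le (hn : 0 < n) (hp : 0 < p) (hp1 : p < 1) (ht : 0 ≤ t)
    (htn : t ≤ 2 * p * (1 - p) * n) {𝓐 : Finset (Finset (Fin n))}
    (h : ∀ A ∈ 𝓐, (#A : ℝ) ≤ p * n - t) :
    biasedMeasure p 𝓐 ≤ Real.exp (-(t ^ 2 / (4 * p * (1 - p) * n))) := by
  have variance_pos : 0 < p * (1 - p) * n :=
    mul_pos (mul_pos hp (sub_pos.2 hp1)) (Nat.cast_pos.2 hn)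
  obtain ⟨s, hs, hs1, hopt⟩ := exists_neg_mul_add_mul_sq_eq variance_pos ht (by linarith)
  calc biasedMeasure p 𝓐
      ≤ ∑ A ∈ 𝓐, biasedWeight p A * Real.exp (s * (p * n - t) + -s * #A) := by
        refine sum_le_sum fun A hA =>
          le_mul_of_one_le_right (biasedWeight_nonneg hp.le hp1.le A) (Real.one_le_exp ?_)
        linarith [mul_le_mul_of_nonneg_left (h A hA) hs]
    _ = Real.exp (s * (p * n - t)) * ∑ A ∈ 𝓐, biasedWeight p A * Real.exp (-s * #A) := by
        simp only [Real.exp_add, mul_sum, mul_left_comm]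
    _ ≤ Real.exp (s * (p * n - t)) * Real.exp (n * (p * -s + p * (1 - p) * (-s) ^ 2)) := by
        gcongr
        exact sum_biasedWeight_mul_exp_le hp.le hp1.le (by rwa [abs_neg, abs_of_nonneg hs]) 𝓐
    _ = Real.exp (-(t ^ 2 / (4 * p * (1 - p) * n))) := by
        rw [← Real.exp_add, mul_assoc 4 p, mul_assoc 4, ← hopt]
        ring_nf

theorem biasedWeight_mul_self_le_tilted (hp : 0 ≤ p) (hp1 : p ≤ 1) (hs : 0 ≤ s)
    {A B : Finset (Fin n)} (h : t ≤ (#(A \ B) : ℝ)) :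
    biasedWeight p A * biasedWeight p B ≤
      Real.exp (-(s * t)) * (biasedWeight p (A ∩ B) * Real.exp (-s * #(A ∩ B))) *
        (biasedWeight p (A ∪ B) * Real.exp (s * #(A ∪ B))) := by
  have spread : t ≤ (#(A ∪ B) : ℝ) - #(A ∩ B) := by
    have h_union : (#(A \ B) : ℝ) + #B = #(A ∪ B) := by exact_mod_cast card_sdiff_add_card A B
    have h_inter : (#(A ∩ B) : ℝ) ≤ #B := by exact_mod_cast card_le_card inter_subset_right
    linarith
  calc biasedWeight p A * biasedWeight p B
      ≤ biasedWeight p (A ∩ B) * biasedWeight p (A ∪ B) := biasedWeight_mul_le hp le_rfl hp1 A B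
    _ ≤ biasedWeight p (A ∩ B) * biasedWeight p (A ∪ B) *
          Real.exp (-(s * t) + -s * #(A ∩ B) + s * #(A ∪ B)) := by
        refine le_mul_of_one_le_right (mul_nonneg (biasedWeight_nonneg hp hp1 _)
          (biasedWeight_nonneg hp hp1 _)) (Real.one_le_exp ?_)
        linarith [mul_le_mul_of_nonneg_left spread hs]
    _ = _ := by
        rw [Real.exp_add, Real.exp_add]
        ring

theorem biasedMeasure_mul_self_le_sum_tilted (hp : 0 ≤ p) (hp1 : p ≤ 1) (hs : 0 ≤ s)
    {𝓐 𝓑 : Finset (Finset (Fin n))} (h : ∀ A ∈ 𝓐, ∀ B ∈ 𝓑, t ≤ (#(A \ B) : ℝ)) :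
    biasedMeasure p 𝓐 * biasedMeasure p 𝓑 ≤
      Real.exp (-(s * t)) * (∑ D ∈ 𝓐 ⊼ 𝓑, biasedWeight p D * Real.exp (-s * #D)) *
        ∑ U ∈ 𝓐 ⊻ 𝓑, biasedWeight p U * Real.exp (s * #U) := by
  have weight_nonneg := biasedWeight_nonneg (n := n) hp hp1
  have tilted_nonneg (u : ℝ) (C : Finset (Fin n)) :
      0 ≤ biasedWeight p C * Real.exp (u * #C) := mul_nonneg (weight_nonneg C) (Real.exp_nonneg _)
  rw [mul_sum (𝓐 ⊼ 𝓑)]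
  exact four_functions_theorem_of_mem weight_nonneg weight_nonneg
    (fun D => mul_nonneg (Real.exp_nonneg _) (tilted_nonneg (-s) D)) (tilted_nonneg s)
    fun A hA B hB => biasedWeight_mul_self_le_tilted hp hp1 hs (h A hA B hB)

theorem biasedMeasure_mul_self_le_of_le_card_sdiff (hn : 0 < n) (hp : 0 < p) (hp1 : p < 1)
    (ht : 0 ≤ t) (htn : t ≤ 4 * p * (1 - p) * n) {𝓐 𝓑 : Finset (Finset (Fin n))}
    (h : ∀ A ∈ 𝓐, ∀ B ∈ 𝓑, t ≤ (#(A \ B) : ℝ)) :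
    biasedMeasure p 𝓐 * biasedMeasure p 𝓑 ≤ Real.exp (-(t ^ 2 / (8 * p * (1 - p) * n))) := by
  have variance_pos : 0 < p * (1 - p) * n :=
    mul_pos (mul_pos hp (sub_pos.2 hp1)) (Nat.cast_pos.2 hn)
  obtain ⟨s, hs, hs1, hopt⟩ := exists_neg_mul_add_mul_sq_eq (mul_pos two_pos variance_pos) ht
    (by linarith)
  calc biasedMeasure p 𝓐 * biasedMeasure p 𝓑
      ≤ Real.exp (-(s * t)) * (∑ D ∈ 𝓐 ⊼ 𝓑, biasedWeight p D * Real.exp (-s * #D)) *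
          ∑ U ∈ 𝓐 ⊻ 𝓑, biasedWeight p U * Real.exp (s * #U) :=
        biasedMeasure_mul_self_le_sum_tilted hp.le hp1.le hs h
    _ ≤ Real.exp (-(s * t)) * Real.exp (n * (p * -s + p * (1 - p) * (-s) ^ 2)) *
          Real.exp (n * (p * s + p * (1 - p) * s ^ 2)) := by
        have hs_abs : |s| ≤ 1 := by rwa [abs_of_nonneg hs]
        gcongr
        · exact sum_nonneg fun U _ =>
            mul_nonneg (biasedWeight_nonneg hp.le hp1.le U) (Real.exp_nonneg _)
        · exact sum_biasedWeight_mul_exp_le hp.le hp1.le (by rwa [abs_neg]) _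
        · exact sum_biasedWeight_mul_exp_le hp.le hp1.le hs_abs _
    _ = Real.exp (-(t ^ 2 / (8 * p * (1 - p) * n))) := by
        rw [← Real.exp_add, ← Real.exp_add,
          show 8 * p * (1 - p) * n = 4 * (2 * (p * (1 - p) * n)) by ring, ← hopt]
        ring_nf

end Concentration

section CrossIntersections

variable {n : ℕ} {p r t : ℝ} {𝓐 𝓑 : Finset (Finset (Fin n))}

theorem biasedMeasure_mul_le_of_le_card_sdiff (hn : 0 < n) (hp : 0 < p) (hp1 : p < 1)
    (hpr : p ≤ r) (hr : r ≤ 1) (ht : 0 ≤ t) (htn : t ≤ 4 * p * (1 - p) * n)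
    (h : ∀ A ∈ 𝓐, ∀ B ∈ 𝓑, t ≤ (#(A \ B) : ℝ)) :
    biasedMeasure p 𝓐 * biasedMeasure r 𝓑 ≤ Real.exp (-(t ^ 2 / (8 * p * (1 - p) * n))) := by
  have h_down : ∀ A ∈ 𝓐, ∀ C ∈ univ ⊼ 𝓑, t ≤ (#(A \ C) : ℝ) := by
    intro A hA C hC
    obtain ⟨X, -, B, hB, rfl⟩ := mem_infs.1 hC
    refine (h A hA B hB).trans ?_
    exact_mod_cast card_le_card (sdiff_subset_sdiff subset_rfl inter_subset_right)
  calc biasedMeasure p 𝓐 * biasedMeasure r 𝓑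
      ≤ biasedMeasure p 𝓐 * biasedMeasure p (univ ⊼ 𝓑) :=
        mul_le_mul_of_nonneg_left (biasedMeasure_le_biasedMeasure_univ_infs hp.le hpr hr 𝓑)
          (biasedMeasure_nonneg hp.le hp1.le 𝓐)
    _ ≤ _ := biasedMeasure_mul_self_le_of_le_card_sdiff hn hp hp1 ht htn h_down

theorem biasedMeasure_mul_le_of_le_card_inter (hn : 0 < n) (hp : 0 < p) (hp1 : p < 1)
    (hr : 0 ≤ r) (hpr : r ≤ 1 - p) (ht : 0 ≤ t) (htn : t ≤ 4 * p * (1 - p) * n)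
    (h : ∀ A ∈ 𝓐, ∀ B ∈ 𝓑, t ≤ (#(A ∩ B) : ℝ)) :
    biasedMeasure p 𝓐 * biasedMeasure r 𝓑 ≤ Real.exp (-(t ^ 2 / (8 * p * (1 - p) * n))) := by
  rw [← biasedMeasure_compls r]
  refine biasedMeasure_mul_le_of_le_card_sdiff hn hp hp1 (by linarith) (by linarith) ht htn
    fun A hA => forall_mem_compls.2 fun B hB => ?_
  rw [sdiff_compl]
  exact h A hA B hB

theorem biasedMeasure_mul_le_of_card_inter_le (hn : 0 < n) (hp : 0 < p) (hp1 : p < 1)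
    (hpr : p ≤ r) (hr : r ≤ 1) (ht : 0 ≤ t) (htn : t ≤ 2 * p * (1 - p) * n)
    (h : ∀ A ∈ 𝓐, ∀ B ∈ 𝓑, (#(A ∩ B) : ℝ) ≤ p * n - t) :
    biasedMeasure p 𝓐 * biasedMeasure r 𝓑 ≤ Real.exp (-(t ^ 2 / (4 * p * (1 - p) * n))) :=
  (biasedMeasure_mul_le_biasedMeasure_infs hp.le hpr hr 𝓐 𝓑).trans
    (biasedMeasure_le_of_card_le hn hp hp1 ht htn (forall_infs_iff.2 h))

end CrossIntersections

theorem lemma3p3_general {n : ℕ} (hn : 0 < n) {p p' : ℝ} (hp : 0 < p) (hp1 : p < 1)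
    (hp'0 : 0 ≤ p') (hp'1 : p' ≤ 1) {α : ℝ} (hα : 0 ≤ α) (hαn : α ≤ 2 * p * (1 - p) * n)
    (𝓕 𝓖 : Finset (Finset (Fin n))) :
    (p' ≤ 1 - p → Forbid n {k : ℕ | (k : ℝ) ≤ α} 𝓕 𝓖 →
      biasedMeasure p 𝓕 * biasedMeasure p' 𝓖 ≤
        Real.exp (-(α ^ 2 / (8 * p * (1 - p) * n)))) ∧
    (p ≤ p' → Forbid n {k : ℕ | p * n - α ≤ (k : ℝ) ∧ k ≤ n} 𝓕 𝓖 →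
      biasedMeasure p 𝓕 * biasedMeasure p' 𝓖 ≤
        Real.exp (-(α ^ 2 / (4 * p * (1 - p) * n)))) := by
  constructor
  · intro hpp' h
    exact biasedMeasure_mul_le_of_le_card_inter hn hp hp1 hp'0 hpp' hα (by linarith)
      fun A hA B hB => (not_le.1 (h A hA B hB)).le
  · intro hpp' h
    exact biasedMeasure_mul_le_of_card_inter_le hn hp hp1 hpp' hp'1 hα hαn
      fun A hA B hB => le_of_not_ge fun hle => h A hA B hB ⟨hle, card_finset_fin_le _⟩

theorem lemma3p3 (n : ℕ) (hn : 0 < n) (p p' : ℝ) (hp : 0 < p) (hpp' : p ≤ p')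
    (hp' : p' ≤ 1 - p) (hp2 : p ≤ 1 / 2) (α : ℕ) (hα : 0 < α) (hαn : (α : ℝ) ≤ p * n)
    (𝓕 𝓖 : Finset (Finset (Fin n))) :
    (Forbid n (Set.Icc 0 α) 𝓕 𝓖 →
      biasedMeasure p 𝓕 * biasedMeasure p' 𝓖 ≤
        Real.exp (-((α : ℝ) ^ 2 / (24 * p * (1 - p) * n)))) ∧
    (Forbid n {k : ℕ | p * n - α ≤ (k : ℝ) ∧ k ≤ n} 𝓕 𝓖 →
      biasedMeasure p 𝓕 * biasedMeasure p' 𝓖 ≤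
        2 * Real.exp (-((α : ℝ) ^ 2 / (24 * p * (1 - p) * n)))) := by
  have hq : 0 < 1 - p := by linarith
  have hαn' : (α : ℝ) ≤ 2 * p * (1 - p) * n := hαn.trans (by gcongr; nlinarith)
  obtain ⟨h_inter, h_avoid⟩ := lemma3p3_general hn hp (by linarith) (by linarith) (by linarith)
    α.cast_nonneg hαn' 𝓕 𝓖
  refine ⟨fun h => (h_inter hp' fun A hA B hB hle => ?_).trans ?_, fun h =>
    (h_avoid hpp' h).trans ((Real.exp_le_exp.2 ?_).trans
      (le_mul_of_one_le_left (Real.exp_nonneg _) one_le_two))⟩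
  · exact h A hA B hB (by simpa using hle)
  all_goals gcongr; norm_num
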